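/- Let $M$ be a smooth $12$-dimensional Riemannian manifold, let $\nabla^{TM}$ be its Levi-Civita connection with curvature $R=R^{TM}$, and put $$\widehat A=\det{}^{1/2}\!\left(\frac{\frac{\sqrt{-1}}{4\pi}R}{\sinh\left(\frac{\sqrt{-1}}{4\pi}R\right)}\right),\qquad \widehat L=\det{}^{1/2}\!\left(\frac{\frac{\sqrt{-1}}{2\pi}R}{\tanh\left(\frac{\sqrt{-1}}{4\pi}R\right)}\right),\qquad \mathrm{ch}(T_{\mathbb C}M)=\mathrm{tr}\,\exp\left(\tfrac{\sqrt{-1}}{2\pi}R\right),$$ differential forms on $M$ (the functions of the nilpotent $R$ are given by their power series, and $\det^{1/2}$ is the square root with positive degree-zero part). Let $\xi$ be a smooth oriented Euclidean vector bundle of rank two over $M$ (equivalently, a complex line bundle with a Hermitian metric) with a smooth Euclidean connection $\nabla^{\xi}$ of curvature $R^{\xi}$, and let $c=e(\xi,\nabla^{\xi})=\frac1{2\pi}\langle R^{\xi}f_2,f_1\rangle$ be its Euler form, where $(f_1,f_2)$ is any local oriented orthonormal frame of $\xi$. Then the components of degree $12$ satisfy, as differential forms on $M$, $$\left\{\widehat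 L\,\tanh^2\left(\tfrac c2\right)\right\}^{(12)}=\left\{\left[-4\,\widehat A\,\mathrm{ch}(T_{\mathbb C}M)+112\,\widehat A+8\,\widehat A\left(e^{c}+e^{-c}-2\right)\right]\sinh^2\left(\tfrac c2\right)\right\}^{(12)}.$$ -/

import Mathlib

open Bundle FiberBundle Module VectorField
open scoped Manifold ContDiff Topology

/-! ### Differential forms at a point

For a real vector space `V` (a tangent space), `V →ₗ[ℝ] ℂ` is the complexified dual `V* ⊗ ℂ`, and
its exterior algebra over `ℂ` is the algebra of complex-valued forms on `V`, with the wedge product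
as multiplication. Forms of even degree make up a commutative subalgebra. -/

/-- The algebra `Λ(V*) ⊗ ℂ` of complex-valued forms on the real vector space `V`. -/
abbrev FormAlgebra (V : Type*) [AddCommGroup V] [Module ℝ V] : Type _ :=
  ExteriorAlgebra ℂ (V →ₗ[ℝ] ℂ)

/-- The algebra of complex-valued forms of even degree on `V`. -/
abbrev EvenForm (V : Type*) [AddCommGroup V] [Module ℝ V] : Type _ :=
  ↥(CliffordAlgebra.even (0 : QuadraticForm ℂ (V →ₗ[ℝ] ℂ)))

/-- A product of two one-forms commutes with every one-form. -/
theorem ExteriorAlgebra.ι_mul_ι_commute_ι {R W : Type*} [CommRing R] [AddCommGroup W] [Module R W]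
    (a b w : W) :
    (ExteriorAlgebra.ι R a * ExteriorAlgebra.ι R b) * ExteriorAlgebra.ι R w =
      ExteriorAlgebra.ι R w * (ExteriorAlgebra.ι R a * ExteriorAlgebra.ι R b) := by
  have h : ∀ u v : W, ExteriorAlgebra.ι R u * ExteriorAlgebra.ι R v =
      -(ExteriorAlgebra.ι R v * ExteriorAlgebra.ι R u) := fun u v =>
    eq_neg_of_add_eq_zero_left (ExteriorAlgebra.ι_add_mul_swap u v)
  rw [mul_assoc, h b w, mul_neg, ← mul_assoc, h a w, neg_mul, neg_neg, mul_assoc]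

/-- A product of two one-forms is central in the exterior algebra. -/
theorem ExteriorAlgebra.ι_mul_ι_commute {R W : Type*} [CommRing R] [AddCommGroup W] [Module R W]
    (a b : W) (x : ExteriorAlgebra R W) :
    (ExteriorAlgebra.ι R a * ExteriorAlgebra.ι R b) * x =
      x * (ExteriorAlgebra.ι R a * ExteriorAlgebra.ι R b) := by
  induction x using ExteriorAlgebra.induction with
  | algebraMap r => exact (Algebra.commutes r _).symm
  | ι w => exact ExteriorAlgebra.ι_mul_ι_commute_ι a b w
  | mul x y hx hy => rw [← mul_assoc, hx, mul_assoc, hy, ← mul_assoc]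
  | add x y hx hy => rw [mul_add, hx, hy, add_mul]

/-- Forms of even degree commute with each other. -/
theorem EvenForm.mul_comm' {V : Type*} [AddCommGroup V] [Module ℝ V] (x y : EvenForm V) :
    x * y = y * x := by
  obtain ⟨x, hx⟩ := x
  obtain ⟨y, hy⟩ := y
  apply Subtype.ext
  change x * y = y * x
  induction x, hx using CliffordAlgebra.even_induction with
  | algebraMap r => exact Algebra.commutes r y
  | add x₁ x₂ _ _ h₁ h₂ => rw [add_mul, mul_add, h₁, h₂]
  | ι_mul_ι_mul a b x _ h =>
    rw [mul_assoc, h, ← mul_assoc, ← mul_assoc]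
    congr 1
    exact ExteriorAlgebra.ι_mul_ι_commute a b y

noncomputable instance EvenForm.instCommRing (V : Type*) [AddCommGroup V] [Module ℝ V] :
    CommRing (EvenForm V) :=
  { (inferInstance : Ring (EvenForm V)) with mul_comm := EvenForm.mul_comm' }

/-- The component of degree `k` of a form. -/
noncomputable def formComponent {V : Type*} [AddCommGroup V] [Module ℝ V] (k : ℕ)
    (a : EvenForm V) : FormAlgebra V :=
  GradedAlgebra.proj (fun i : ℕ => ⋀[ℂ]^i (V →ₗ[ℝ] ℂ)) k (a : FormAlgebra V)

/-- A real linear form on `V`, viewed as a complex-valued one. -/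
noncomputable def complexifyDual {V : Type*} [AddCommGroup V] [Module ℝ V] (f : V →ₗ[ℝ] ℝ) :
    V →ₗ[ℝ] ℂ :=
  Complex.ofRealCLM.toLinearMap ∘ₗ f

/-- The two-form `½ ∑ₐ ∑ᵦ α(eₐ, eᵦ) eᵃ ∧ eᵇ` given by an alternating bilinear map `α` on `V`.
Here `(eₐ)` is a basis of `V` and `(eᵃ)` is its dual basis; the result does not depend on it. -/
noncomputable def twoForm {V : Type*} [AddCommGroup V] [Module ℝ V] [FiniteDimensional ℝ V]
    (α : V → V → ℝ) : EvenForm V :=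
  (1 / 2 : ℂ) • ∑ a, ∑ b, ((α (finBasis ℝ V a) (finBasis ℝ V b) : ℝ) : ℂ) •
    (CliffordAlgebra.even.ι (0 : QuadraticForm ℂ (V →ₗ[ℝ] ℂ))).bilin
      (complexifyDual ((finBasis ℝ V).coord a)) (complexifyDual ((finBasis ℝ V).coord b))

/-! ### Power series in nilpotent elements -/

/-- The value `∑ₖ fₖ aᵏ` of a formal power series `f` at a nilpotent element `a`
(a finite sum, as `aᵏ = 0` from the nilpotency class of `a` on). -/
noncomputable def evalSeries {A : Type*} [Ring A] [Algebra ℂ A] (f : PowerSeries ℂ) (a : A) : A :=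
  ∑ k ∈ Finset.range (nilpotencyClass a), PowerSeries.coeff k f • a ^ k

/-- `exp z = ∑ zᵏ / k!`. -/
noncomputable def expSeries : PowerSeries ℂ := PowerSeries.exp ℂ

/-- `sinh z = ∑_{k odd} zᵏ / k!`. -/
noncomputable def sinhSeries : PowerSeries ℂ :=
  PowerSeries.mk fun k => if Odd k then ((k.factorial : ℂ))⁻¹ else 0

/-- `cosh z = ∑_{k even} zᵏ / k!`. -/
noncomputable def coshSeries : PowerSeries ℂ :=
  PowerSeries.mk fun k => if Even k then ((k.factorial : ℂ))⁻¹ else 0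

/-- `tanh z = sinh z / cosh z`. -/
noncomputable def tanhSeries : PowerSeries ℂ := sinhSeries * coshSeries⁻¹

/-- `sinh z / z = ∑_{k even} zᵏ / (k + 1)!`. -/
noncomputable def sinhDivSeries : PowerSeries ℂ :=
  PowerSeries.mk fun k => if Even k then (((k + 1).factorial : ℂ))⁻¹ else 0

/-- `z / sinh z`. -/
noncomputable def divSinhSeries : PowerSeries ℂ := sinhDivSeries⁻¹

/-- `z / tanh z = cosh z / (sinh z / z)`. -/
noncomputable def divTanhSeries : PowerSeries ℂ := coshSeries * sinhDivSeries⁻¹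

/-- `(1 + z)^{1/2} = ∑ binom(1/2, k) zᵏ`. -/
noncomputable def sqrtOneAddSeries : PowerSeries ℂ :=
  PowerSeries.mk fun k => Ring.choose (1 / 2 : ℂ) k

/-- The square root of an even form `a` whose degree zero part `β` is nonzero:
`β^{1/2} (1 + (β⁻¹ a - 1))^{1/2}`, with the principal root of the number `β`
(below, `β` is a positive real number, and `β^{1/2}` is its positive root). -/
noncomputable def sqrtForm {V : Type*} [AddCommGroup V] [Module ℝ V] (a : EvenForm V) :
    EvenForm V :=
  (ExteriorAlgebra.algebraMapInv (a : FormAlgebra V) ^ (1 / 2 : ℂ)) •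
    evalSeries sqrtOneAddSeries ((ExteriorAlgebra.algebraMapInv (a : FormAlgebra V))⁻¹ • a - 1)

/-- `det^{1/2}` of a matrix of even forms. -/
noncomputable def sqrtDet {V : Type*} [AddCommGroup V] [Module ℝ V] {ι : Type*} [Fintype ι]
    [DecidableEq ι] (A : Matrix ι ι (EvenForm V)) : EvenForm V :=
  sqrtForm A.det

/-! ### Curvature of a connection -/

section Curvature

variable {E : Type*} [NormedAddCommGroup E] [NormedSpace ℝ E] [FiniteDimensional ℝ E]
  {H : Type*} [TopologicalSpace H] {I : ModelWithCorners ℝ E H}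
  {M : Type*} [TopologicalSpace M] [ChartedSpace H M] [IsManifold I ∞ M]
  {F : Type*} [NormedAddCommGroup F] [NormedSpace ℝ F]
  {W : M → Type*} [TopologicalSpace (TotalSpace F W)]
  [∀ x, AddCommGroup (W x)] [∀ x, Module ℝ (W x)] [∀ x, TopologicalSpace (W x)]
  [∀ x, IsTopologicalAddGroup (W x)] [∀ x, ContinuousSMul ℝ (W x)] [FiberBundle F W]

instance TangentSpace.instFiniteDimensionalReal (x : M) :
    FiniteDimensional ℝ (TangentSpace I x) :=
  inferInstanceAs (FiniteDimensional ℝ E)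

/-- The curvature `R(u, v) s = ∇_X ∇_Y S - ∇_Y ∇_X S - ∇_[X, Y] S` at the point `x`, where `X`, `Y`
are vector fields and `S` is a section, smooth near `x`, with values `u`, `v`, `s` at `x`
(for a smooth connection the result does not depend on the extensions).
Recall that `∇ S x u` stands for `(∇_u S)(x)`. -/
noncomputable def CovariantDerivative.curvatureAt (cov : CovariantDerivative I F W) (x : M)
    (u v : TangentSpace I x) (s : W x) : W x :=
  cov (fun y => cov (extend F s) y (extend E v y)) x u
    - cov (fun y => cov (extend F s) y (extend E u y)) x v
    - cov (extend F s) x (mlieBracket I (extend E u) (extend E v) x)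

/-- The matrix of two-forms of the curvature `R = ∇²` at `x` with respect to a basis `b` of the
fibre: `R(u, v) bⱼ = ∑ᵢ Ωᵢⱼ(u, v) bᵢ`. -/
noncomputable def CovariantDerivative.curvatureMatrix (cov : CovariantDerivative I F W) (x : M)
    {ι : Type*} (b : Basis ι ℝ (W x)) : Matrix ι ι (EvenForm (TangentSpace I x)) :=
  Matrix.of fun i j => twoForm fun u v => b.repr (cov.curvatureAt x u v (b j)) i

end Curvature

/-! ### Characteristic forms of the tangent bundle -/

section TangentBundle

variable {E : Type*} [NormedAddCommGroup E] [NormedSpace ℝ E] [FiniteDimensional ℝ E]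
  {H : Type*} [TopologicalSpace H] {I : ModelWithCorners ℝ E H}
  {M : Type*} [TopologicalSpace M] [ChartedSpace H M] [IsManifold I ∞ M]

/-- The curvature matrix `R^{TM}` at `x`, with respect to a basis of `T_x M`. The same matrix is
the curvature matrix of the induced connection on `T_ℂ M`. All characteristic forms
below are invariant under conjugation, so that they do not depend on the basis. -/
noncomputable def tangentCurvature (cov : CovariantDerivative I E (TangentSpace I : M → Type _))
    (x : M) : Matrix (Fin (finrank ℝ (TangentSpace I x))) (Fin (finrank ℝ (TangentSpace I x)))
      (EvenForm (TangentSpace I x)) :=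
  cov.curvatureMatrix x (finBasis ℝ (TangentSpace I x))

/-- `Â(TM, ∇) = det^{1/2} ( (√-1/4π) R / sinh((√-1/4π) R) )`. -/
noncomputable def aHatForm (cov : CovariantDerivative I E (TangentSpace I : M → Type _)) (x : M) :
    EvenForm (TangentSpace I x) :=
  sqrtDet (evalSeries divSinhSeries ((Complex.I / (4 * Real.pi)) • tangentCurvature cov x))

/-- `L̂(TM, ∇) = det^{1/2} ( (√-1/2π) R / tanh((√-1/4π) R) )`; the matrix is
`2 (z / tanh z)` at `z = (√-1/4π) R`. -/
noncomputable def lHatForm (cov : CovariantDerivative I E (TangentSpace I : M → Type _)) (x : M) :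
    EvenForm (TangentSpace I x) :=
  sqrtDet ((2 : ℂ) •
    evalSeries divTanhSeries ((Complex.I / (4 * Real.pi)) • tangentCurvature cov x))

/-- The Chern character form `ch(T_ℂ M, ∇) = tr exp((√-1/2π) R)` of the complexified tangent
bundle with the induced connection. -/
noncomputable def chernCharacterForm (cov : CovariantDerivative I E (TangentSpace I : M → Type _))
    (x : M) : EvenForm (TangentSpace I x) :=
  (evalSeries expSeries ((Complex.I / (2 * Real.pi)) • tangentCurvature cov x)).trace

/-- `∇` is the Levi-Civita connection of the Riemannian metric `g`: it is smooth, metric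
(`v ⟨Y, Z⟩ = ⟨∇_v Y, Z⟩ + ⟨Y, ∇_v Z⟩`) and torsion free. -/
structure IsLeviCivita (g : ContMDiffRiemannianMetric I ∞ E (fun x : M => TangentSpace I x))
    (cov : CovariantDerivative I E (fun x : M => TangentSpace I x)) : Prop where
  smooth : cov.ContMDiffCovariantDerivative ∞
  metric : ∀ (Y Z : ∀ x : M, TangentSpace I x) (x : M),
    MDiffAt (T% Y) x → MDiffAt (T% Z) x → ∀ v : TangentSpace I x,
      d% (fun y : M => g.inner y (Y y) (Z y)) x v =
        g.inner x (cov Y x v) (Z x) + g.inner x (Y x) (cov Z x v)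
  torsionFree : cov.torsion = 0

end TangentBundle

/-! ### Oriented Euclidean plane bundles and their Euler form -/

section PlaneBundle

variable {M : Type*} [TopologicalSpace M]
  (ξ : M → Type*) [TopologicalSpace (TotalSpace (EuclideanSpace ℝ (Fin 2)) ξ)]
  [∀ x, NormedAddCommGroup (ξ x)] [∀ x, InnerProductSpace ℝ (ξ x)]
  [FiberBundle (EuclideanSpace ℝ (Fin 2)) ξ] [VectorBundle ℝ (EuclideanSpace ℝ (Fin 2)) ξ]

/-- An orientation of a plane bundle: an orientation of every fibre, locally constant in the
local trivializations of the bundle. -/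
structure PlaneBundleOrientation where
  /-- The orientation of the fibre. -/
  orientation : ∀ x, Orientation ℝ (ξ x) (Fin 2)
  locallyConstant : ∀ x, ∀ᶠ y in 𝓝 x,
    ∀ hx : x ∈ (trivializationAt (EuclideanSpace ℝ (Fin 2)) ξ x).baseSet,
    ∀ hy : y ∈ (trivializationAt (EuclideanSpace ℝ (Fin 2)) ξ x).baseSet,
      Orientation.map (Fin 2) ((trivializationAt (EuclideanSpace ℝ (Fin 2)) ξ
          x).continuousLinearEquivAt ℝ y hy).toLinearEquiv (orientation y) =
        Orientation.map (Fin 2) ((trivializationAt (EuclideanSpace ℝ (Fin 2)) ξ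
          x).continuousLinearEquivAt ℝ x hx).toLinearEquiv (orientation x)

/-- The fibres of a plane bundle have dimension two. -/
theorem finrank_planeBundle (x : M) : finrank ℝ (ξ x) = 2 := by
  rw [((trivializationAt (EuclideanSpace ℝ (Fin 2)) ξ x).continuousLinearEquivAt ℝ x
    (mem_baseSet_trivializationAt' x)).toLinearEquiv.finrank_eq, finrank_euclideanSpace_fin]

variable {ξ}
variable {E : Type*} [NormedAddCommGroup E] [NormedSpace ℝ E] [FiniteDimensional ℝ E]
  {H : Type*} [TopologicalSpace H] {I : ModelWithCorners ℝ E H}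
  [ChartedSpace H M] [IsManifold I ∞ M]

/-- The Euler form `e(ξ, ∇) = (1/2π) ⟨R f₂, f₁⟩` at `x`, where `(f₁, f₂)` is an oriented
orthonormal basis of the fibre `ξ_x`. -/
noncomputable def eulerForm (cov : CovariantDerivative I (EuclideanSpace ℝ (Fin 2)) ξ)
    (o : PlaneBundleOrientation ξ) (x : M) : EvenForm (TangentSpace I x) :=
  let f := (o.orientation x).finOrthonormalBasis (by norm_num) (finrank_planeBundle ξ x)
  twoForm fun u v => (1 / (2 * Real.pi)) * inner ℝ (cov.curvatureAt x u v (f 1)) (f 0)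

end PlaneBundle

/-!
The identity holds at each point and for purely algebraic reasons: it is an identity in the
commutative algebra of even forms on the tangent space, for an arbitrary `12 × 12` matrix `Z` of
two-forms (here `Z = (√-1/4π) R`) and an arbitrary two-form `y` (here `y = c/2`).

Let `J` be the ideal of even forms of positive degree. It is generated by nilpotent elements, so
power series in elements of `J` may be truncated modulo powers of `J`, and `J⁷` has no component of
degree `12`. Write `Tₖ = tr Zᵏ`. A genus `det^{1/2} f(Z)` with `f = 1 + α z² + β z⁴ + …` even is

  `1 + (α/2) T₂ + (β/2 - α²/4) T₄ + (α²/8) T₂²`  modulo `J⁶`  (`mk_sqrt_det_evalSeries`),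

by the second order expansion of a determinant (`Matrix.two_mul_det_one_add`). Hence
`Â = 1 - T₂/12 + T₄/360 + T₂²/288` and `L̂ = 2⁶ (1 + T₂/6 - 7 T₄/180 + T₂²/72)`, while
`ch = 12 + 2 T₁ + 2 T₂ + (4/3) T₃ + (2/3) T₄` modulo `J⁵`. This is precise enough, as `tanh² y` and
`sinh² y` lie in `J²`. With these expansions the terms of degree `12` of the two sides agree
(`signature_sub_dirac_mem`). The odd power sums `T₁` and `T₃` only contribute monomials whose degree
as a form is not divisible by four.
-/

/-! ### Taylor coefficients -/

section Coefficients

open PowerSeries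

theorem coeff_sinhSeries :
    coeff 0 sinhSeries = 0 ∧ coeff 1 sinhSeries = 1 ∧ coeff 2 sinhSeries = 0 ∧
      coeff 3 sinhSeries = 1 / 6 ∧ coeff 4 sinhSeries = 0 ∧ coeff 5 sinhSeries = 1 / 120 := by
  simp only [sinhSeries, coeff_mk, Nat.odd_iff]
  norm_num [Nat.factorial]

theorem coeff_tanhSeries :
    coeff 0 tanhSeries = 0 ∧ coeff 1 tanhSeries = 1 ∧ coeff 2 tanhSeries = 0 ∧
      coeff 3 tanhSeries = -1 / 3 ∧ coeff 4 tanhSeries = 0 ∧ coeff 5 tanhSeries = 2 / 15 := by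
  have h : tanhSeries * coshSeries = sinhSeries := by
    rw [tanhSeries, mul_assoc, PowerSeries.inv_mul_cancel, mul_one]
    simp [coshSeries]
  have h0 := congrArg (coeff 0) h
  have h1 := congrArg (coeff 1) h
  have h2 := congrArg (coeff 2) h
  have h3 := congrArg (coeff 3) h
  have h4 := congrArg (coeff 4) h
  have h5 := congrArg (coeff 5) h
  simp only [coeff_mul, Finset.Nat.antidiagonal_succ, Finset.Nat.antidiagonal_zero, coshSeries,
    sinhSeries, coeff_mk, Nat.even_iff, Nat.odd_iff, Finset.sum_cons,
    Finset.map_singleton, Finset.sum_singleton, Finset.map_cons, Function.Embedding.prodMap,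
    Function.Embedding.coeFn_mk, Prod.map_apply, Function.Embedding.refl_apply] at h0 h1 h2 h3 h4 h5
  norm_num [Nat.factorial] at h0 h1 h2 h3 h4 h5
  rw [← coeff_zero_eq_constantCoeff_apply] at *
  refine ⟨h0, ?_, ?_, ?_, ?_, ?_⟩
  · linear_combination h1
  · linear_combination h2 - h0 / 2
  · linear_combination h3 - h1 / 2
  · linear_combination h4 - h2 / 2 + 5 * h0 / 24
  · linear_combination h5 - h3 / 2 + 5 * h1 / 24

theorem coeff_divSinhSeries :
    coeff 0 divSinhSeries = 1 ∧ coeff 1 divSinhSeries = 0 ∧ coeff 2 divSinhSeries = -1 / 6 ∧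
      coeff 3 divSinhSeries = 0 ∧ coeff 4 divSinhSeries = 7 / 360 ∧
      coeff 5 divSinhSeries = 0 := by
  have h : divSinhSeries * sinhDivSeries = 1 := by
    rw [divSinhSeries, PowerSeries.inv_mul_cancel]
    simp [sinhDivSeries]
  have h0 := congrArg (coeff 0) h
  have h1 := congrArg (coeff 1) h
  have h2 := congrArg (coeff 2) h
  have h3 := congrArg (coeff 3) h
  have h4 := congrArg (coeff 4) h
  have h5 := congrArg (coeff 5) h
  simp only [coeff_mul, Finset.Nat.antidiagonal_succ, Finset.Nat.antidiagonal_zero, sinhDivSeries,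
    coeff_mk, Nat.even_iff, coeff_one, Finset.sum_cons,
    Finset.map_singleton, Finset.sum_singleton, Finset.map_cons, Function.Embedding.prodMap,
    Function.Embedding.coeFn_mk, Prod.map_apply, Function.Embedding.refl_apply] at h0 h1 h2 h3 h4 h5
  norm_num [Nat.factorial] at h0 h1 h2 h3 h4 h5
  rw [← coeff_zero_eq_constantCoeff_apply] at *
  refine ⟨h0, ?_, ?_, ?_, ?_, ?_⟩
  · linear_combination h1
  · linear_combination h2 - h0 / 6
  · linear_combination h3 - h1 / 6
  · linear_combination h4 - h2 / 6 + 7 * h0 / 360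
  · linear_combination h5 - h3 / 6 + 7 * h1 / 360

theorem coeff_divTanhSeries :
    coeff 0 divTanhSeries = 1 ∧ coeff 1 divTanhSeries = 0 ∧ coeff 2 divTanhSeries = 1 / 3 ∧
      coeff 3 divTanhSeries = 0 ∧ coeff 4 divTanhSeries = -1 / 45 ∧
      coeff 5 divTanhSeries = 0 := by
  have h : divTanhSeries * sinhDivSeries = coshSeries := by
    rw [divTanhSeries, mul_assoc, PowerSeries.inv_mul_cancel, mul_one]
    simp [sinhDivSeries]
  have h0 := congrArg (coeff 0) h
  have h1 := congrArg (coeff 1) h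
  have h2 := congrArg (coeff 2) h
  have h3 := congrArg (coeff 3) h
  have h4 := congrArg (coeff 4) h
  have h5 := congrArg (coeff 5) h
  simp only [coeff_mul, Finset.Nat.antidiagonal_succ, Finset.Nat.antidiagonal_zero, sinhDivSeries,
    coshSeries, coeff_mk, Nat.even_iff, Finset.sum_cons,
    Finset.map_singleton, Finset.sum_singleton, Finset.map_cons, Function.Embedding.prodMap,
    Function.Embedding.coeFn_mk, Prod.map_apply, Function.Embedding.refl_apply] at h0 h1 h2 h3 h4 h5
  norm_num [Nat.factorial] at h0 h1 h2 h3 h4 h5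
  rw [← coeff_zero_eq_constantCoeff_apply] at *
  refine ⟨h0, ?_, ?_, ?_, ?_, ?_⟩
  · linear_combination h1
  · linear_combination h2 - h0 / 6
  · linear_combination h3 - h1 / 6
  · linear_combination h4 - h2 / 6 + 7 * h0 / 360
  · linear_combination h5 - h3 / 6 + 7 * h1 / 360

theorem coeff_sqrtOneAddSeries :
    coeff 0 sqrtOneAddSeries = 1 ∧ coeff 1 sqrtOneAddSeries = 1 / 2 ∧
      coeff 2 sqrtOneAddSeries = -1 / 8 := by
  refine ⟨by simp [sqrtOneAddSeries], by simp [sqrtOneAddSeries], ?_⟩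
  rw [sqrtOneAddSeries, coeff_mk, Ring.choose_eq_smul, descPochhammer_succ_right]
  simp [Polynomial.smeval_mul, Polynomial.smeval_sub]
  norm_num

end Coefficients

/-! ### Power series modulo powers of an ideal -/

section Truncation

open Finset

/-- The truncation of a power series at a nilpotent element after `m` terms. -/
theorem evalSeries_eq_sum_add_pow_mul {R : Type*} [Ring R] [Algebra ℂ R] (f : PowerSeries ℂ)
    {a : R} (ha : IsNilpotent a) (m : ℕ) :
    ∃ b, evalSeries f a = ∑ k ∈ range m, PowerSeries.coeff k f • a ^ k + a ^ m * b := by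
  set N := nilpotencyClass a
  have h : evalSeries f a = ∑ k ∈ range (m + N), PowerSeries.coeff k f • a ^ k := by
    refine Finset.sum_subset (fun k hk => by simp at hk ⊢; omega) fun k _ hk => ?_
    rw [pow_eq_zero_of_le (by simpa using hk) (pow_nilpotencyClass ha), smul_zero]
  refine ⟨∑ k ∈ range N, PowerSeries.coeff (m + k) f • a ^ k, ?_⟩
  simp_rw [h, sum_range_add, mul_sum, mul_smul_comm, pow_add]

theorem mk_evalSeries {A : Type*} [CommRing A] [Algebra ℂ A] {I : Ideal A}
    (f : PowerSeries ℂ) {a : A} (hn : IsNilpotent a) {m : ℕ} (ha : a ^ m ∈ I) :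
    Ideal.Quotient.mk I (evalSeries f a) =
      ∑ k ∈ range m, PowerSeries.coeff k f • Ideal.Quotient.mk I a ^ k := by
  obtain ⟨b, hb⟩ := evalSeries_eq_sum_add_pow_mul f hn m
  rw [hb, map_add, Ideal.Quotient.eq_zero_iff_mem.2 (Ideal.mul_mem_right _ _ ha), add_zero,
    map_sum]
  refine sum_congr rfl fun k _ => ?_
  rw [← map_pow]
  rfl

end Truncation

/-! ### Matrices with entries in an ideal -/

section Matrices

open Matrix Finset

variable {A : Type*} [CommRing A] {n : Type*} [Fintype n]

theorem Matrix.mul_apply_mem_mul {I J : Ideal A} {X Y : Matrix n n A} (hX : ∀ i j, X i j ∈ I)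
    (hY : ∀ i j, Y i j ∈ J) (i j : n) : (X * Y) i j ∈ I * J := by
  rw [Matrix.mul_apply]
  exact sum_mem fun k _ => Ideal.mul_mem_mul (hX i k) (hY k j)

variable [DecidableEq n]

theorem Matrix.pow_apply_mem_pow {J : Ideal A} {X : Matrix n n A} (hX : ∀ i j, X i j ∈ J)
    (k : ℕ) (i j : n) : (X ^ k) i j ∈ J ^ k := by
  induction k generalizing i j with
  | zero => simp
  | succ k ih =>
    rw [pow_succ, pow_succ]
    exact Matrix.mul_apply_mem_mul ih hX i j

theorem Matrix.isNilpotent_of_forall_apply {X : Matrix n n A} (hX : ∀ i j, IsNilpotent (X i j)) :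
    IsNilpotent X := by
  let s : Set A := Set.range fun p : n × n => X p.1 p.2
  obtain ⟨N, hN⟩ := (Ideal.FG.isNilpotent_iff_le_nilradical
    (Submodule.fg_span (Set.finite_range _) : (Ideal.span s).FG)).2 <| by
      rw [Ideal.span_le]
      rintro _ ⟨p, rfl⟩
      exact hX p.1 p.2
  refine ⟨N, Matrix.ext fun i j => ?_⟩
  have h := Matrix.pow_apply_mem_pow (J := Ideal.span s)
    (fun i j => Ideal.subset_span ⟨(i, j), rfl⟩) N i j
  rwa [hN] at h

theorem Matrix.map_mk_evalSeries [Algebra ℂ A] {I : Ideal A} (f : PowerSeries ℂ)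
    {X : Matrix n n A} (hn : ∀ i j, IsNilpotent (X i j)) {m : ℕ}
    (hX : ∀ i j, (X ^ m) i j ∈ I) :
    (evalSeries f X).map (Ideal.Quotient.mk I) =
      ∑ k ∈ range m, PowerSeries.coeff k f • X.map (Ideal.Quotient.mk I) ^ k := by
  obtain ⟨B, hB⟩ := evalSeries_eq_sum_add_pow_mul f (Matrix.isNilpotent_of_forall_apply hn) m
  let φ : Matrix n n A →+* Matrix n n (A ⧸ I) := (Ideal.Quotient.mk I).mapMatrix
  have h0 : φ (X ^ m) = 0 := Matrix.ext fun i j => Ideal.Quotient.eq_zero_iff_mem.2 (hX i j)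
  change φ _ = _
  rw [hB, map_add, map_mul, h0, zero_mul, add_zero, map_sum]
  refine sum_congr rfl fun k _ => ?_
  change _ = PowerSeries.coeff k f • φ X ^ k
  rw [← map_pow]
  rfl

theorem Matrix.comp_det_one_add_X_smul (X : Matrix n n A) (q : Polynomial A) :
    (1 + (Polynomial.X : Polynomial A) • X.map Polynomial.C).det.comp q =
      (1 + q • X.map Polynomial.C).det := by
  rw [← Polynomial.coe_compRingHom_apply, RingHom.map_det]
  congr 1
  ext1 i j
  simp [Matrix.one_apply, apply_ite (fun p : Polynomial A => p.comp q),
    mul_comm q]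

/-- The second elementary symmetric function of the eigenvalues is determined by the first two
power sums: compare the coefficients of `t²` in
`det (1 + t X) det (1 - t X) = det (1 - t² X²)`. -/
theorem Matrix.two_mul_coeff_two_det_one_add_X_smul (X : Matrix n n A) :
    2 * (1 + (Polynomial.X : Polynomial A) • X.map Polynomial.C).det.coeff 2 =
      X.trace ^ 2 - (X ^ 2).trace := by
  set P := (1 + (Polynomial.X : Polynomial A) • X.map Polynomial.C).det with hP
  set Q := (1 + (Polynomial.X : Polynomial A) • (X ^ 2).map Polynomial.C).det with hQ
  have h : P * P.comp (-Polynomial.X) = Q.comp (-Polynomial.X ^ 2) := by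
    rw [hP, hQ, Matrix.comp_det_one_add_X_smul, Matrix.comp_det_one_add_X_smul, ← Matrix.det_mul]
    congr 1
    rw [← RingHom.mapMatrix_apply, ← RingHom.mapMatrix_apply, map_pow]
    simp only [add_mul, mul_add, one_mul, mul_one, smul_mul_smul_comm, neg_smul, mul_neg, pow_two]
    abel
  have hQ' : Q.comp (-Polynomial.X ^ 2) =
      1 - Polynomial.C (X ^ 2).trace * Polynomial.X ^ 2 +
        Q.divX.divX.comp (-Polynomial.X ^ 2) * Polynomial.X ^ 4 := by
    conv_lhs => rw [hQ, Matrix.det_one_add_X_smul, ← hQ]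
    simp [Polynomial.smul_eq_C_mul]
    ring
  have hP' : P = 1 + Polynomial.C X.trace * Polynomial.X + P.divX.divX * Polynomial.X ^ 2 := by
    conv_lhs => rw [hP, Matrix.det_one_add_X_smul, ← hP, Polynomial.smul_eq_C_mul]
  have hR : (P.divX.divX.comp (-Polynomial.X)).coeff 0 = P.coeff 2 := by
    rw [Polynomial.coeff_zero_eq_eval_zero, Polynomial.eval_comp]
    simp [← Polynomial.coeff_zero_eq_eval_zero]
  have hPP : P * P.comp (-Polynomial.X) =
      1 + (P.divX.divX + P.divX.divX.comp (-Polynomial.X) - Polynomial.C (X.trace ^ 2)) *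
          Polynomial.X ^ 2 +
        (Polynomial.C X.trace * (P.divX.divX.comp (-Polynomial.X) - P.divX.divX)) *
          Polynomial.X ^ 3 +
        (P.divX.divX * P.divX.divX.comp (-Polynomial.X)) * Polynomial.X ^ 4 := by
    have hPc := congrArg (fun p => p.comp (-Polynomial.X)) hP'
    simp only [Polynomial.add_comp, Polynomial.mul_comp, Polynomial.one_comp, Polynomial.C_comp,
      Polynomial.X_comp, Polynomial.X_pow_comp] at hPc
    rw [hPc, map_pow]
    linear_combination (1 - Polynomial.C X.trace * Polynomial.X +
      P.divX.divX.comp (-Polynomial.X) * Polynomial.X ^ 2) * hP'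
  have h' := congrArg (fun p => Polynomial.coeff p 2) (hPP.symm.trans (h.trans hQ'))
  simp [-map_pow, Polynomial.coeff_one, Polynomial.coeff_mul_X_pow', hR] at h'
  linear_combination h'

/-- Expansion of a determinant near the identity matrix to second order. -/
theorem Matrix.two_mul_det_one_add {K : Ideal A} (hK : K ^ 3 = ⊥) {X : Matrix n n A}
    (hX : ∀ i j, X i j ∈ K) :
    2 * (1 + X).det = 2 + 2 * X.trace + X.trace ^ 2 - (X ^ 2).trace := by
  set P := (1 + (Polynomial.X : Polynomial A) • X.map Polynomial.C).det with hP
  -- The coefficient of `tᵏ` in `det (1 + t X)` lies in `Kᵏ`, as for the entries of `1 + t X`.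
  have hmem : P ∈ reesAlgebra K := by
    rw [hP, Matrix.det_apply]
    refine sum_mem fun σ _ => ?_
    refine zsmul_mem (prod_mem fun i _ => ?_) _
    rw [Matrix.add_apply]
    refine add_mem ?_ ?_
    · rw [Matrix.one_apply]
      split_ifs
      exacts [one_mem _, zero_mem _]
    · rw [Matrix.smul_apply, Matrix.map_apply, smul_eq_mul, mul_comm, ← pow_one Polynomial.X,
        Polynomial.C_mul_X_pow_eq_monomial]
      exact reesAlgebra.monomial_mem.2 (by simpa using hX _ _)
  have h3 : ∀ k, 3 ≤ k → P.coeff k = 0 := fun k hk => by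
    have := Ideal.pow_le_pow_right hk ((mem_reesAlgebra_iff _ _).1 hmem k)
    rwa [hK] at this
  have hP0 : P.coeff 0 = 1 := by
    rw [Polynomial.coeff_zero_eq_eval_zero, hP, eval_det_add_X_smul]
    simp
  have heval : (1 + X).det = P.eval 1 := by
    rw [hP, ← Polynomial.coe_evalRingHom, RingHom.map_det]
    congr 1
    ext1 i j
    simp [Matrix.one_apply, apply_ite (Polynomial.eval (1 : A))]
  have hdeg : P.natDegree < 3 := by
    refine lt_of_le_of_lt (Polynomial.natDegree_le_iff_coeff_eq_zero.2 fun k hk => h3 k hk) (by norm_num : 2 < 3)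
  rw [heval, Polynomial.eval_eq_sum_range' hdeg]
  simp only [sum_range_succ, range_zero, sum_empty, one_pow, mul_one, zero_add, hP0]
  linear_combination 2 * Matrix.coeff_det_one_add_X_smul_one X +
    Matrix.two_mul_coeff_two_det_one_add_X_smul X

end Matrices

/-! ### Truncation of the characteristic forms -/

section Genera

open Matrix Finset

variable {A : Type*} [CommRing A] [Algebra ℂ A] {n : Type*} [Fintype n] [DecidableEq n]
  {J : Ideal A}

theorem det_evalSeries_sub_one_mem (hJ : J ≤ nilradical A) {f : PowerSeries ℂ}
    (h0 : PowerSeries.coeff 0 f = 1) (h1 : PowerSeries.coeff 1 f = 0) {Z : Matrix n n A}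
    (hZ : ∀ i j, Z i j ∈ J) : (evalSeries f Z).det - 1 ∈ J ^ 2 := by
  rw [← Ideal.Quotient.eq_zero_iff_mem, map_sub, map_one, RingHom.map_det, RingHom.mapMatrix_apply,
    Matrix.map_mk_evalSeries f (fun i j => hJ (hZ i j)) (Matrix.pow_apply_mem_pow hZ 2)]
  simp [sum_range_succ, h0, h1]

/-- The genus `det^{1/2} f(Z)` of an even power series `f = 1 + α z² + β z⁴ + …`, up to terms of
order six in the entries of `Z`, in terms of the power sums `tr Z²` and `tr Z⁴`. -/
theorem mk_sqrt_det_evalSeries (hJ : J ≤ nilradical A) {f : PowerSeries ℂ} {α β : ℂ}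
    (h0 : PowerSeries.coeff 0 f = 1) (h1 : PowerSeries.coeff 1 f = 0)
    (h2 : PowerSeries.coeff 2 f = α) (h3 : PowerSeries.coeff 3 f = 0)
    (h4 : PowerSeries.coeff 4 f = β) (h5 : PowerSeries.coeff 5 f = 0)
    {Z : Matrix n n A} (hZ : ∀ i j, Z i j ∈ J) :
    Ideal.Quotient.mk (J ^ 6) (evalSeries sqrtOneAddSeries ((evalSeries f Z).det - 1)) =
      Ideal.Quotient.mk (J ^ 6) (1 + (α / 2) • (Z ^ 2).trace +
        (β / 2 - α ^ 2 / 4) • (Z ^ 4).trace + (α ^ 2 / 8) • (Z ^ 2).trace ^ 2) := by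
  have hn := det_evalSeries_sub_one_mem hJ h0 h1 hZ
  have hn3 : ((evalSeries f Z).det - 1) ^ 3 ∈ J ^ 6 := by
    have := Ideal.pow_mem_pow hn 3
    rwa [← pow_mul] at this
  rw [mk_evalSeries _ (hJ (Ideal.pow_le_self two_ne_zero hn)) hn3]
  have hT : ∀ k, (Z ^ k).trace ∈ J ^ k := fun k =>
    sum_mem fun i _ => Matrix.pow_apply_mem_pow hZ k i i
  have h222 : Ideal.Quotient.mk (J ^ 6) (Z ^ 2).trace ^ 3 = 0 := by
    rw [← map_pow, Ideal.Quotient.eq_zero_iff_mem]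
    have := Ideal.pow_mem_pow (hT 2) 3
    rwa [← pow_mul] at this
  have h24 : Ideal.Quotient.mk (J ^ 6) (Z ^ 2).trace * Ideal.Quotient.mk (J ^ 6) (Z ^ 4).trace
      = 0 := by
    rw [← map_mul, Ideal.Quotient.eq_zero_iff_mem, show 6 = 2 + 4 from rfl, pow_add]
    exact Ideal.mul_mem_mul (hT 2) (hT 4)
  have h44 : Ideal.Quotient.mk (J ^ 6) (Z ^ 4).trace ^ 2 = 0 := by
    rw [← map_pow, Ideal.Quotient.eq_zero_iff_mem]
    have := Ideal.pow_mem_pow (hT 4) 2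
    rw [← pow_mul] at this
    exact Ideal.pow_le_pow_right (by norm_num) this
  let φ : Matrix n n A →+* Matrix n n (A ⧸ J ^ 6) := (Ideal.Quotient.mk (J ^ 6)).mapMatrix
  have hφ : ∀ k, (φ Z ^ k).trace = Ideal.Quotient.mk (J ^ 6) (Z ^ k).trace := fun k => by
    rw [← map_pow, RingHom.mapMatrix_apply, AddMonoidHom.map_trace]
  have hφ6 : φ Z ^ 6 = 0 := by
    rw [← map_pow]
    exact Matrix.ext fun i j =>
      Ideal.Quotient.eq_zero_iff_mem.2 (Matrix.pow_apply_mem_pow hZ 6 i j)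
  set X : Matrix n n (A ⧸ J ^ 6) := α • φ Z ^ 2 + β • φ Z ^ 4 with hX
  have hfX : (evalSeries f Z).map (Ideal.Quotient.mk (J ^ 6)) = 1 + X := by
    rw [Matrix.map_mk_evalSeries f (fun i j => hJ (hZ i j)) (Matrix.pow_apply_mem_pow hZ 6), hX]
    simp only [sum_range_succ, range_zero, sum_empty, h0, h1, h2, h3, h4, h5, φ,
      RingHom.mapMatrix_apply]
    simp [add_assoc]
  have hX2 : X ^ 2 = α ^ 2 • φ Z ^ 4 := by
    have h8 : φ Z ^ 8 = 0 := by rw [show 8 = 6 + 2 from rfl, pow_add, hφ6, zero_mul]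
    simp only [hX, pow_two (_ + _), add_mul, mul_add, smul_mul_smul_comm, ← pow_add]
    simp [hφ6, h8, pow_two]
  have hK : (J.map (Ideal.Quotient.mk (J ^ 6)) ^ 2) ^ 3 = ⊥ := by
    rw [← pow_mul, ← Ideal.map_pow, Ideal.map_quotient_self]
  have hXK : ∀ i j, X i j ∈ J.map (Ideal.Quotient.mk (J ^ 6)) ^ 2 := fun i j => by
    have hφJ : ∀ i j, φ Z i j ∈ J.map (Ideal.Quotient.mk (J ^ 6)) := fun i j =>
      Ideal.mem_map_of_mem _ (hZ i j)
    refine add_mem (Submodule.smul_of_tower_mem _ α ?_) (Submodule.smul_of_tower_mem _ β ?_)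
    · exact Matrix.pow_apply_mem_pow hφJ 2 i j
    · exact Ideal.pow_le_pow_right (by norm_num) (Matrix.pow_apply_mem_pow hφJ 4 i j)
  have hmk : ∀ (c : ℂ) (a : A),
      Ideal.Quotient.mk (J ^ 6) (c • a) = c • Ideal.Quotient.mk (J ^ 6) a := fun _ _ => rfl
  have hdet := Matrix.two_mul_det_one_add hK hXK
  rw [hX2] at hdet
  simp only [hX, trace_add, trace_smul, hφ] at hdet
  rw [← hX, ← hfX, ← RingHom.mapMatrix_apply, ← RingHom.map_det] at hdet
  simp only [sum_range_succ, range_zero, sum_empty, coeff_sqrtOneAddSeries, map_sub, map_add,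
    map_one, map_pow, hmk] at hdet ⊢
  generalize Ideal.Quotient.mk (J ^ 6) (evalSeries f Z).det = D at *
  generalize Ideal.Quotient.mk (J ^ 6) (Z ^ 2).trace = T at *
  generalize Ideal.Quotient.mk (J ^ 6) (Z ^ 4).trace = S at *
  have hD : D = 1 + α • T + (β - α ^ 2 / 2) • S + (α ^ 2 / 2) • T ^ 2 := by
    linear_combination (norm := algebra) (algebraMap ℂ (A ⧸ J ^ 6) (1 / 2)) * hdet +
      (α * β) • h24 + (β ^ 2 / 2) • h44
  rw [hD]
  linear_combination (norm := algebra) (-(α * (β - α ^ 2 / 2)) / 4) • h24 +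
    (-α ^ 3 / 8) • h222 + (-(β - α ^ 2 / 2) ^ 2 / 8) • h44 +
    (-(β - α ^ 2 / 2) * α ^ 2 / 8) • (congrArg (T * ·) h24) + (-α ^ 4 / 32) • (congrArg (T * ·) h222)

end Genera

/-! ### The identity modulo terms of order seven -/

section Cancellation

open Finset

variable {A : Type*} [CommRing A] {J : Ideal A}

theorem Ideal.mul_mem_pow_of_le {i j k : ℕ} {a b : A} (ha : a ∈ J ^ i) (hb : b ∈ J ^ j)
    (h : k ≤ i + j) : a * b ∈ J ^ k :=
  Ideal.pow_le_pow_right h (by rw [pow_add]; exact Ideal.mul_mem_mul ha hb)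

variable [Algebra ℂ A]

theorem evalSeries_sub_sum_mem (hJ : J ≤ nilradical A) (f : PowerSeries ℂ) {a : A} (ha : a ∈ J)
    (m : ℕ) : evalSeries f a - ∑ k ∈ range m, PowerSeries.coeff k f • a ^ k ∈ J ^ m := by
  rw [← Ideal.Quotient.eq, mk_evalSeries f (hJ ha) (Ideal.pow_mem_pow ha m), map_sum]
  refine sum_congr rfl fun k _ => ?_
  rw [← map_pow]
  rfl

/-- The square of an odd power series `z + α z³ + β z⁵ + …`. -/
theorem evalSeries_sq_sub_mem (hJ : J ≤ nilradical A) {f : PowerSeries ℂ} {α β : ℂ}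
    (h0 : PowerSeries.coeff 0 f = 0) (h1 : PowerSeries.coeff 1 f = 1)
    (h2 : PowerSeries.coeff 2 f = 0) (h3 : PowerSeries.coeff 3 f = α)
    (h4 : PowerSeries.coeff 4 f = 0) (h5 : PowerSeries.coeff 5 f = β) {y : A} (hy : y ∈ J) :
    evalSeries f y ^ 2 - (y ^ 2 + (2 * α) • y ^ 4 + (α ^ 2 + 2 * β) • y ^ 6) ∈ J ^ 7 := by
  have h := evalSeries_sub_sum_mem hJ f hy 6
  simp only [sum_range_succ, range_zero, sum_empty, h0, h1, h2, h3, h4, h5, zero_smul, zero_add,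
    add_zero, one_smul, pow_one] at h
  set s := evalSeries f y
  set p : A := y + α • y ^ 3 + β • y ^ 5 with hp
  have hyJ : ∀ k, k ≠ 0 → y ^ k ∈ J := fun k hk => Ideal.pow_le_self hk (Ideal.pow_mem_pow hy k)
  have hpJ : p ∈ J := add_mem (add_mem hy (Submodule.smul_of_tower_mem _ _ (hyJ 3 (by norm_num))))
    (Submodule.smul_of_tower_mem _ _ (hyJ 5 (by norm_num)))
  have hsp : s + p ∈ J ^ 1 := by
    rw [pow_one, show s + p = (s - p) + (p + p) by ring]
    exact add_mem (Ideal.pow_le_self (by norm_num) h) (add_mem hpJ hpJ)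
  have key : s ^ 2 - (y ^ 2 + (2 * α) • y ^ 4 + (α ^ 2 + 2 * β) • y ^ 6) =
      (s - p) * (s + p) + y ^ 7 * ((2 * α * β) • y + β ^ 2 • y ^ 3) := by
    rw [hp]
    algebra
  rw [key]
  exact add_mem (Ideal.mul_mem_pow_of_le h hsp (by norm_num))
    (Ideal.mul_mem_right _ _ (Ideal.pow_mem_pow hy 7))

theorem sinhSeries_sq_sub_mem (hJ : J ≤ nilradical A) {y : A} (hy : y ∈ J) :
    evalSeries sinhSeries y ^ 2 -
      (y ^ 2 + (1 / 3 : ℂ) • y ^ 4 + (2 / 45 : ℂ) • y ^ 6) ∈ J ^ 7 := by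
  obtain ⟨h0, h1, h2, h3, h4, h5⟩ := coeff_sinhSeries
  convert evalSeries_sq_sub_mem hJ h0 h1 h2 h3 h4 h5 hy using 6 <;> norm_num

theorem tanhSeries_sq_sub_mem (hJ : J ≤ nilradical A) {y : A} (hy : y ∈ J) :
    evalSeries tanhSeries y ^ 2 -
      (y ^ 2 + (-2 / 3 : ℂ) • y ^ 4 + (17 / 45 : ℂ) • y ^ 6) ∈ J ^ 7 := by
  obtain ⟨h0, h1, h2, h3, h4, h5⟩ := coeff_tanhSeries
  convert evalSeries_sq_sub_mem hJ h0 h1 h2 h3 h4 h5 hy using 6 <;> norm_num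

theorem expSeries_add_expSeries_neg_sub_mem (hJ : J ≤ nilradical A) {y c : A} (hy : y ∈ J)
    (hc : c = (2 : ℂ) • y) :
    evalSeries expSeries c + evalSeries expSeries (-c) - 2 -
      ((4 : ℂ) • y ^ 2 + (4 / 3 : ℂ) • y ^ 4) ∈ J ^ 5 := by
  have hcJ : c ∈ J := hc ▸ Submodule.smul_of_tower_mem _ _ hy
  have h := add_mem (evalSeries_sub_sum_mem hJ expSeries hcJ 5)
    (evalSeries_sub_sum_mem hJ expSeries (neg_mem hcJ) 5)
  simp only [sum_range_succ, range_zero, sum_empty, expSeries, PowerSeries.coeff_exp] at h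
  norm_num [Nat.factorial] at h
  refine (congrArg (· ∈ J ^ 5) ?_).mp h
  rw [hc]
  simp only [expSeries]
  algebra

theorem trace_expSeries_sub_mem {n : Type*} [Fintype n] [DecidableEq n] (hJ : J ≤ nilradical A)
    {Z : Matrix n n A} (hZ : ∀ i j, Z i j ∈ J) :
    (evalSeries expSeries ((2 : ℂ) • Z)).trace -
      ((Fintype.card n : A) + (2 : ℂ) • Z.trace + (2 : ℂ) • (Z ^ 2).trace +
        (4 / 3 : ℂ) • (Z ^ 3).trace + (2 / 3 : ℂ) • (Z ^ 4).trace) ∈ J ^ 5 := by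
  have hZ2 : ∀ i j, ((2 : ℂ) • Z) i j ∈ J := fun i j => Submodule.smul_of_tower_mem _ _ (hZ i j)
  obtain ⟨B, hB⟩ := evalSeries_eq_sum_add_pow_mul expSeries
    (Matrix.isNilpotent_of_forall_apply fun i j => hJ (hZ2 i j)) 5
  have hBJ : ((((2 : ℂ) • Z) ^ 5) * B).trace ∈ J ^ 5 := sum_mem fun i _ => by
    rw [Matrix.diag_apply, Matrix.mul_apply]
    exact sum_mem fun k _ => Ideal.mul_mem_right _ _ (Matrix.pow_apply_mem_pow hZ2 5 i k)
  rw [hB, Matrix.trace_add]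
  generalize ((((2 : ℂ) • Z) ^ 5) * B).trace = r at hBJ ⊢
  simp only [sum_range_succ, range_zero, sum_empty, expSeries, PowerSeries.coeff_exp, smul_pow,
    Matrix.trace_add, Matrix.trace_smul]
  refine (congrArg (· ∈ J ^ 5) ?_).mp hBJ
  norm_num [Nat.factorial, smul_smul, Matrix.trace_one]

/-- The identity before taking components. The two sides differ, modulo terms of order seven, by
monomials of order at most five; with `Tₖ = tr Zᵏ`, `Z` a matrix of two-forms, and `y` a two-form,
none of them has degree `12`. -/
theorem signature_sub_dirac_mem {Â L ch E y t s T₁ T₂ T₃ T₄ : A}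
    (hA : Â - (1 + (-1 / 12 : ℂ) • T₂ + (1 / 360 : ℂ) • T₄ + (1 / 288 : ℂ) • T₂ ^ 2) ∈ J ^ 5)
    (hL : L - (64 : ℂ) • (1 + (1 / 6 : ℂ) • T₂ + (-7 / 180 : ℂ) • T₄ + (1 / 72 : ℂ) • T₂ ^ 2)
      ∈ J ^ 5)
    (hch : ch - (12 + (2 : ℂ) • T₁ + (2 : ℂ) • T₂ + (4 / 3 : ℂ) • T₃ + (2 / 3 : ℂ) • T₄) ∈ J ^ 5)
    (hE : E - ((4 : ℂ) • y ^ 2 + (4 / 3 : ℂ) • y ^ 4) ∈ J ^ 5)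
    (ht : t - (y ^ 2 + (-2 / 3 : ℂ) • y ^ 4 + (17 / 45 : ℂ) • y ^ 6) ∈ J ^ 7)
    (hs : s - (y ^ 2 + (1 / 3 : ℂ) • y ^ 4 + (2 / 45 : ℂ) • y ^ 6) ∈ J ^ 7)
    (hy : y ∈ J) (h1 : T₁ ∈ J) (h2 : T₂ ∈ J ^ 2) (h3 : T₃ ∈ J ^ 3) (h4 : T₄ ∈ J ^ 4) :
    L * t - (-4 * (Â * ch) + 112 * Â + 8 * (Â * E)) * s -
      ((24 : ℂ) • (T₂ * y ^ 2) + (-96 : ℂ) • y ^ 4 + (8 : ℂ) • (T₁ * y ^ 2) +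
        (16 / 3 : ℂ) • (T₃ * y ^ 2) + (-2 / 3 : ℂ) • (T₁ * T₂ * y ^ 2) +
        (8 / 3 : ℂ) • (T₁ * y ^ 4)) ∈ J ^ 7 := by
  have hy' : ∀ k, y ^ k ∈ J ^ k := fun k => Ideal.pow_mem_pow hy k
  have sm : ∀ {k : ℕ} (c : ℂ) {a : A}, a ∈ J ^ k → c • a ∈ J ^ k := fun c _ h =>
    Submodule.smul_of_tower_mem _ c h
  have hle : ∀ {i : ℕ} (j : ℕ) {a : A}, a ∈ J ^ i → j ≤ i → a ∈ J ^ j := fun _ _ h hij =>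
    Ideal.pow_le_pow_right hij h
  have h1' : T₁ ∈ J ^ 1 := by rwa [pow_one]
  have h22 : T₂ ^ 2 ∈ J ^ 4 := by
    have := Ideal.pow_mem_pow h2 2
    rwa [← pow_mul] at this
  set a₂ : A := (-1 / 12 : ℂ) • T₂ with ha₂
  set a₄ : A := (1 / 360 : ℂ) • T₄ + (1 / 288 : ℂ) • T₂ ^ 2 with ha₄
  set l₂ : A := (32 / 3 : ℂ) • T₂ with hl₂
  set l₄ : A := (-112 / 45 : ℂ) • T₄ + (8 / 9 : ℂ) • T₂ ^ 2 with hl₄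
  have ha₂m : a₂ ∈ J ^ 2 := sm _ h2
  have ha₄m : a₄ ∈ J ^ 4 := add_mem (sm _ h4) (sm _ h22)
  have hl₂m : l₂ ∈ J ^ 2 := sm _ h2
  have hl₄m : l₄ ∈ J ^ 4 := add_mem (sm _ h4) (sm _ h22)
  -- `uᵢ` is the part of order `i` of the factor in front of `sinh²`, whose constant term is `64`.
  set u₁ : A := (-8 : ℂ) • T₁ with hu₁
  set u₂ : A := (-40 / 3 : ℂ) • T₂ + (32 : ℂ) • y ^ 2 with hu₂
  set u₃ : A := (-16 / 3 : ℂ) • T₃ + (2 / 3 : ℂ) • (T₁ * T₂) with hu₃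
  set u₄ : A := (-112 / 45 : ℂ) • T₄ + (8 / 9 : ℂ) • T₂ ^ 2 + (32 / 3 : ℂ) • y ^ 4 +
    (-8 / 3 : ℂ) • (T₂ * y ^ 2) with hu₄
  have hu₁m : u₁ ∈ J ^ 1 := sm _ h1'
  have hu₂m : u₂ ∈ J ^ 2 := add_mem (sm _ h2) (sm _ (hy' 2))
  have hu₃m : u₃ ∈ J ^ 3 := add_mem (sm _ h3) (sm _ (Ideal.mul_mem_pow_of_le h1' h2 le_rfl))
  have hu₄m : u₄ ∈ J ^ 4 := add_mem (add_mem (add_mem (sm _ h4) (sm _ h22)) (sm _ (hy' 4)))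
    (sm _ (Ideal.mul_mem_pow_of_le h2 (hy' 2) le_rfl))
  set U : A := (64 : ℂ) • 1 + u₁ + u₂ + u₃ + u₄ with hU
  set W : A := -4 * (Â * ch) + 112 * Â + 8 * (Â * E) with hW
  have hWU : W - U ∈ J ^ 5 := by
    set Â' : A := 1 + (-1 / 12 : ℂ) • T₂ + (1 / 360 : ℂ) • T₄ + (1 / 288 : ℂ) • T₂ ^ 2 with hA'
    set ch' : A := 12 + (2 : ℂ) • T₁ + (2 : ℂ) • T₂ + (4 / 3 : ℂ) • T₃ + (2 / 3 : ℂ) • T₄ with hch'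
    set E' : A := (4 : ℂ) • y ^ 2 + (4 / 3 : ℂ) • y ^ 4 with hE'
    have key : W - U = (Â - Â') * (-4 * ch + 112 + 8 * E) + Â' * (8 * (E - E') - 4 * (ch - ch')) +
        a₂ * (8 * ((4 / 3 : ℂ) • y ^ 4) - 4 * ((4 / 3 : ℂ) • T₃ + (2 / 3 : ℂ) • T₄)) +
        a₄ * (8 * E' - 4 * ((2 : ℂ) • T₁ + (2 : ℂ) • T₂ + (4 / 3 : ℂ) • T₃ + (2 / 3 : ℂ) • T₄)) := by
      rw [hW, hU, hu₁, hu₂, hu₃, hu₄, ha₂, ha₄, hA', hch', hE']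
      algebra
    rw [key]
    refine add_mem (add_mem (add_mem (Ideal.mul_mem_right _ _ hA) (Ideal.mul_mem_left _ _
      (sub_mem (Ideal.mul_mem_left _ _ hE) (Ideal.mul_mem_left _ _ hch)))) ?_) ?_
    · refine Ideal.mul_mem_pow_of_le (j := 3) ha₂m (sub_mem (Ideal.mul_mem_left _ _ ?_)
        (Ideal.mul_mem_left _ _ ?_)) le_rfl
      · exact hle 3 (sm _ (hy' 4)) (by norm_num)
      · exact add_mem (sm _ h3) (hle 3 (sm _ h4) (by norm_num))
    · refine Ideal.mul_mem_pow_of_le (j := 1) ha₄m (sub_mem (Ideal.mul_mem_left _ _ ?_)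
        (Ideal.mul_mem_left _ _ ?_)) le_rfl
      · exact add_mem (hle 1 (sm _ (hy' 2)) (by norm_num)) (hle 1 (sm _ (hy' 4)) (by norm_num))
      · exact add_mem (add_mem (add_mem (sm _ h1') (hle 1 (sm _ h2) (by norm_num)))
          (hle 1 (sm _ h3) (by norm_num))) (hle 1 (sm _ h4) (by norm_num))
  set L' : A := (64 : ℂ) • (1 + (1 / 6 : ℂ) • T₂ + (-7 / 180 : ℂ) • T₄ + (1 / 72 : ℂ) • T₂ ^ 2)
    with hL'
  set t' : A := y ^ 2 + (-2 / 3 : ℂ) • y ^ 4 + (17 / 45 : ℂ) • y ^ 6 with ht'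
  set s' : A := y ^ 2 + (1 / 3 : ℂ) • y ^ 4 + (2 / 45 : ℂ) • y ^ 6 with hs'
  have ht'm : t' ∈ J ^ 2 := add_mem (add_mem (hy' 2) (hle 2 (sm _ (hy' 4)) (by norm_num)))
    (hle 2 (sm _ (hy' 6)) (by norm_num))
  have hs'm : s' ∈ J ^ 2 := add_mem (add_mem (hy' 2) (hle 2 (sm _ (hy' 4)) (by norm_num)))
    (hle 2 (sm _ (hy' 6)) (by norm_num))
  have key : L * t - W * s -
      ((24 : ℂ) • (T₂ * y ^ 2) + (-96 : ℂ) • y ^ 4 + (8 : ℂ) • (T₁ * y ^ 2) +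
        (16 / 3 : ℂ) • (T₃ * y ^ 2) + (-2 / 3 : ℂ) • (T₁ * T₂ * y ^ 2) +
        (8 / 3 : ℂ) • (T₁ * y ^ 4)) =
      L * (t - t') + (L - L') * t' - W * (s - s') - (W - U) * s' +
      ((-2 / 3 : ℂ) • (l₄ * y ^ 4) + (17 / 45 : ℂ) • ((l₂ + l₄) * y ^ 6)) -
      ((1 / 3 : ℂ) • ((u₃ + u₄) * y ^ 4) + (2 / 45 : ℂ) • ((u₁ + u₂ + u₃ + u₄) * y ^ 6)) := by
    rw [hL', ht', hs', hU, hl₂, hl₄, hu₁, hu₂, hu₃, hu₄]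
    algebra
  rw [key]
  refine sub_mem (add_mem (sub_mem (sub_mem (add_mem (Ideal.mul_mem_left _ _ ht)
    (Ideal.mul_mem_pow_of_le hL ht'm le_rfl)) (Ideal.mul_mem_left _ _ hs))
    (Ideal.mul_mem_pow_of_le hWU hs'm le_rfl)) (add_mem (sm _ ?_) (sm _ ?_)))
    (add_mem (sm _ ?_) (sm _ ?_))
  · exact Ideal.mul_mem_pow_of_le hl₄m (hy' 4) (by norm_num)
  · exact Ideal.mul_mem_pow_of_le (add_mem hl₂m (hle 2 hl₄m (by norm_num))) (hy' 6) (by norm_num)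
  · exact Ideal.mul_mem_pow_of_le (add_mem hu₃m (hle 3 hu₄m (by norm_num))) (hy' 4) (by norm_num)
  · exact Ideal.mul_mem_pow_of_le (add_mem (add_mem (add_mem hu₁m (hle 1 hu₂m (by norm_num)))
      (hle 1 hu₃m (by norm_num))) (hle 1 hu₄m (by norm_num))) (hy' 6) (by norm_num)

end Cancellation

/-! ### The ideal of forms of positive even degree -/

section Forms

variable {V : Type*} [AddCommGroup V] [Module ℝ V]

/-- The ideal of the even forms without component of degree zero, which is generated by the
products of two one-forms. -/
noncomputable def EvenForm.positiveIdeal (V : Type*) [AddCommGroup V] [Module ℝ V] : Ideal (EvenForm V) :=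
  Ideal.span (Set.range fun p : (V →ₗ[ℝ] ℂ) × (V →ₗ[ℝ] ℂ) =>
    (CliffordAlgebra.even.ι (0 : QuadraticForm ℂ (V →ₗ[ℝ] ℂ))).bilin p.1 p.2)

theorem EvenForm.coe_bilin (a b : V →ₗ[ℝ] ℂ) :
    (((CliffordAlgebra.even.ι (0 : QuadraticForm ℂ (V →ₗ[ℝ] ℂ))).bilin a b : EvenForm V) :
      FormAlgebra V) = ExteriorAlgebra.ι ℂ a * ExteriorAlgebra.ι ℂ b := rfl

theorem EvenForm.bilin_mem_positiveIdeal (a b : V →ₗ[ℝ] ℂ) :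
    (CliffordAlgebra.even.ι (0 : QuadraticForm ℂ (V →ₗ[ℝ] ℂ))).bilin a b ∈
      EvenForm.positiveIdeal V :=
  Ideal.subset_span ⟨(a, b), rfl⟩

theorem EvenForm.bilin_mem_grade_two (a b : V →ₗ[ℝ] ℂ) :
    (((CliffordAlgebra.even.ι (0 : QuadraticForm ℂ (V →ₗ[ℝ] ℂ))).bilin a b : EvenForm V) :
      FormAlgebra V) ∈ ⋀[ℂ]^2 (V →ₗ[ℝ] ℂ) := by
  change _ ∈ LinearMap.range (ExteriorAlgebra.ι ℂ (M := V →ₗ[ℝ] ℂ)) ^ 2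
  rw [EvenForm.coe_bilin, pow_two]
  exact Submodule.mul_mem_mul ⟨a, rfl⟩ ⟨b, rfl⟩

theorem EvenForm.positiveIdeal_le_nilradical :
    EvenForm.positiveIdeal V ≤ nilradical (EvenForm V) := by
  rw [EvenForm.positiveIdeal, Ideal.span_le]
  rintro _ ⟨⟨a, b⟩, rfl⟩
  refine ⟨2, Subtype.ext ?_⟩
  change (ExteriorAlgebra.ι ℂ a * ExteriorAlgebra.ι ℂ b) ^ 2 = 0
  rw [pow_two, ← mul_assoc, ExteriorAlgebra.ι_mul_ι_commute a b (ExteriorAlgebra.ι ℂ a),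
    ← mul_assoc, ExteriorAlgebra.ι_sq_zero, zero_mul, zero_mul]

theorem EvenForm.algebraMapInv_eq_zero {x : EvenForm V} (hx : x ∈ EvenForm.positiveIdeal V) :
    ExteriorAlgebra.algebraMapInv (x : FormAlgebra V) = 0 := by
  let φ : EvenForm V →+* ℂ :=
    (ExteriorAlgebra.algebraMapInv (R := ℂ) (M := V →ₗ[ℝ] ℂ)).toRingHom.comp
      (CliffordAlgebra.even (0 : QuadraticForm ℂ (V →ₗ[ℝ] ℂ))).val.toRingHom
  have h : EvenForm.positiveIdeal V ≤ RingHom.ker φ := by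
    rw [EvenForm.positiveIdeal, Ideal.span_le]
    rintro _ ⟨⟨a, b⟩, rfl⟩
    change ExteriorAlgebra.algebraMapInv (ExteriorAlgebra.ι ℂ a * ExteriorAlgebra.ι ℂ b) = 0
    rw [map_mul]
    simp [ExteriorAlgebra.algebraMapInv]
  exact h hx

theorem formComponent_add (k : ℕ) (x y : EvenForm V) :
    formComponent k (x + y) = formComponent k x + formComponent k y := by
  simp [formComponent]

theorem formComponent_sub (k : ℕ) (x y : EvenForm V) :
    formComponent k (x - y) = formComponent k x - formComponent k y := by
  simp [formComponent]

theorem formComponent_smul (k : ℕ) (c : ℂ) (x : EvenForm V) :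
    formComponent k (c • x) = c • formComponent k x := by
  simp [formComponent]

theorem formComponent_eq_zero_of_mem_pow {m k : ℕ} (hk : k < 2 * m) {x : EvenForm V}
    (hx : x ∈ EvenForm.positiveIdeal V ^ m) : formComponent k x = 0 := by
  induction m generalizing k x with
  | zero => omega
  | succ m ih =>
    rw [pow_succ] at hx
    induction hx using Submodule.mul_induction_on' with
    | mem_mul_mem y hy z hz =>
      induction hz using Submodule.span_induction generalizing y with
      | mem z hz =>
        obtain ⟨⟨a, b⟩, rfl⟩ := hz
        have h2 := EvenForm.bilin_mem_grade_two a b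
        by_cases h : 2 ≤ k
        · exact (DirectSum.coe_decompose_mul_of_right_mem_of_le
            (fun i : ℕ => ⋀[ℂ]^i (V →ₗ[ℝ] ℂ)) h2 h (a := (y : FormAlgebra V))).trans 
              ((congrArg (· * _) (ih (k := k - 2) (by omega) hy)).trans (zero_mul _))
        · exact DirectSum.coe_decompose_mul_of_right_mem_of_not_le
            (fun i : ℕ => ⋀[ℂ]^i (V →ₗ[ℝ] ℂ)) h2 h
      | zero => rw [mul_zero]; simp [formComponent]
      | add z₁ z₂ _ _ h₁ h₂ =>
        rw [mul_add, formComponent_add, h₁ y hy, h₂ y hy, add_zero]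
      | smul r z _ h =>
        rw [smul_eq_mul, ← mul_assoc]
        exact h _ (Ideal.mul_mem_right _ _ hy)
    | add x _ y _ hx hy => rw [formComponent_add, hx, hy, add_zero]

/-- The even forms that are homogeneous of degree `2 k`. -/
noncomputable def EvenForm.homogeneous (V : Type*) [AddCommGroup V] [Module ℝ V] (k : ℕ) :
    Submodule ℂ (EvenForm V) :=
  (⋀[ℂ]^(2 * k) (V →ₗ[ℝ] ℂ)).comap
    (CliffordAlgebra.even (0 : QuadraticForm ℂ (V →ₗ[ℝ] ℂ))).val.toLinearMap

theorem EvenForm.mul_mem_homogeneous {j k : ℕ} {x y : EvenForm V}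
    (hx : x ∈ EvenForm.homogeneous V j) (hy : y ∈ EvenForm.homogeneous V k) :
    x * y ∈ EvenForm.homogeneous V (j + k) := by
  have : ((x : FormAlgebra V) * (y : FormAlgebra V)) ∈ ⋀[ℂ]^(2 * (j + k)) (V →ₗ[ℝ] ℂ) := by
    rw [mul_add]
    exact SetLike.mul_mem_graded (A := fun i : ℕ => ⋀[ℂ]^i (V →ₗ[ℝ] ℂ)) hx hy
  exact this

theorem EvenForm.one_mem_homogeneous : (1 : EvenForm V) ∈ EvenForm.homogeneous V 0 :=
  SetLike.one_mem_graded (fun i : ℕ => ⋀[ℂ]^i (V →ₗ[ℝ] ℂ))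

theorem EvenForm.pow_mem_homogeneous {x : EvenForm V} (hx : x ∈ EvenForm.homogeneous V 1)
    (k : ℕ) : x ^ k ∈ EvenForm.homogeneous V k := by
  induction k with
  | zero => rw [pow_zero]; exact EvenForm.one_mem_homogeneous
  | succ k ih => rw [pow_succ]; exact EvenForm.mul_mem_homogeneous ih hx

theorem EvenForm.matrix_pow_mem_homogeneous {n : Type*} [Fintype n] [DecidableEq n]
    {Z : Matrix n n (EvenForm V)} (hZ : ∀ i j, Z i j ∈ EvenForm.homogeneous V 1) (k : ℕ) (i j : n) :
    (Z ^ k) i j ∈ EvenForm.homogeneous V k := by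
  induction k generalizing i j with
  | zero =>
    rw [pow_zero, Matrix.one_apply]
    split_ifs
    exacts [EvenForm.one_mem_homogeneous, zero_mem _]
  | succ k ih =>
    rw [pow_succ, Matrix.mul_apply]
    exact sum_mem fun l _ => EvenForm.mul_mem_homogeneous (ih i l) (hZ l j)

theorem formComponent_eq_zero_of_mem_homogeneous {j k : ℕ} (h : 2 * j ≠ k) {x : EvenForm V}
    (hx : x ∈ EvenForm.homogeneous V j) : formComponent k x = 0 :=
  DirectSum.decompose_of_mem_ne (fun i : ℕ => ⋀[ℂ]^i (V →ₗ[ℝ] ℂ)) hx h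

theorem twoForm_mem_positiveIdeal [FiniteDimensional ℝ V] (α : V → V → ℝ) :
    twoForm α ∈ EvenForm.positiveIdeal V :=
  Submodule.smul_of_tower_mem _ _ <| sum_mem fun _ _ => sum_mem fun _ _ =>
    Submodule.smul_of_tower_mem _ _ <| EvenForm.bilin_mem_positiveIdeal _ _

theorem twoForm_mem_homogeneous [FiniteDimensional ℝ V] (α : V → V → ℝ) :
    twoForm α ∈ EvenForm.homogeneous V 1 :=
  Submodule.smul_mem _ _ <| sum_mem fun _ _ => sum_mem fun _ _ =>
    Submodule.smul_mem _ _ <| EvenForm.bilin_mem_grade_two _ _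

/-- The square root of `β a`, for an even form `a` with constant term one. -/
theorem sqrtForm_smul {β : ℂ} (hβ : β ≠ 0) {a : EvenForm V}
    (ha : a - 1 ∈ EvenForm.positiveIdeal V) :
    sqrtForm (β • a) = β ^ (1 / 2 : ℂ) • evalSeries sqrtOneAddSeries (a - 1) := by
  have h1 : ExteriorAlgebra.algebraMapInv (a : FormAlgebra V) = 1 := by
    have := EvenForm.algebraMapInv_eq_zero ha
    rw [show ((a - 1 : EvenForm V) : FormAlgebra V) = (a : FormAlgebra V) - 1 from rfl, map_sub,
      map_one] at this
    exact sub_eq_zero.1 this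
  have h : ExteriorAlgebra.algebraMapInv ((β • a : EvenForm V) : FormAlgebra V) = β := by
    rw [show ((β • a : EvenForm V) : FormAlgebra V) = β • (a : FormAlgebra V) from rfl, map_smul,
      h1, smul_eq_mul, mul_one]
  rw [sqrtForm, h, smul_smul, inv_mul_cancel₀ hβ, one_smul]

end Forms

/-! ### Characteristic forms of a connection -/

section CharacteristicForms

variable {V : Type*} [AddCommGroup V] [Module ℝ V] {n : Type*} [Fintype n] [DecidableEq n]

/-- The genus `det^{1/2} (β f(Z))` of a matrix `Z` of forms of positive degree. -/
theorem sqrtDet_smul_evalSeries_sub_mem {β : ℂ} (hβ : β ≠ 0) {f : PowerSeries ℂ} {α γ p q r : ℂ}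
    (hf : PowerSeries.coeff 0 f = 1 ∧ PowerSeries.coeff 1 f = 0 ∧ PowerSeries.coeff 2 f = α ∧
      PowerSeries.coeff 3 f = 0 ∧ PowerSeries.coeff 4 f = γ ∧ PowerSeries.coeff 5 f = 0)
    (hp : α / 2 = p) (hq : γ / 2 - α ^ 2 / 4 = q) (hr : α ^ 2 / 8 = r)
    {Z : Matrix n n (EvenForm V)} (hZ : ∀ i j, Z i j ∈ EvenForm.positiveIdeal V) :
    sqrtDet (β • evalSeries f Z) - (β ^ Fintype.card n) ^ (1 / 2 : ℂ) •
      (1 + p • (Z ^ 2).trace + q • (Z ^ 4).trace + r • (Z ^ 2).trace ^ 2) ∈ EvenForm.positiveIdeal V ^ 5 := by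
  subst hp hq hr
  obtain ⟨h0, h1, h2, h3, h4, h5⟩ := hf
  have hJ := EvenForm.positiveIdeal_le_nilradical (V := V)
  have hdet : (β • evalSeries f Z).det = β ^ Fintype.card n • (evalSeries f Z).det :=
    Matrix.det_smul_of_tower _ _
  rw [sqrtDet, hdet, sqrtForm_smul (pow_ne_zero _ hβ)
    (Ideal.pow_le_self two_ne_zero (det_evalSeries_sub_one_mem hJ h0 h1 hZ)), ← smul_sub]
  exact Submodule.smul_of_tower_mem _ _ (Ideal.pow_le_pow_right (by norm_num)
    ((Ideal.Quotient.eq).1 (mk_sqrt_det_evalSeries hJ h0 h1 h2 h3 h4 h5 hZ)))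

theorem formComponent_eq_of_sub_sub_mem {m k : ℕ} (hk : k < 2 * m) {x y z : EvenForm V}
    (h : x - y - z ∈ EvenForm.positiveIdeal V ^ m) (hz : formComponent k z = 0) :
    formComponent k x = formComponent k y := by
  have h0 := formComponent_eq_zero_of_mem_pow hk h
  rwa [formComponent_sub, formComponent_sub, hz, sub_zero, sub_eq_zero] at h0

/-- The identity at a point, for an arbitrary `12 × 12` matrix `Z` of two-forms and an arbitrary
two-form `y`. -/
theorem formComponent_signature_eq_dirac (hn : Fintype.card n = 12)
    {Z : Matrix n n (EvenForm V)} (hZ : ∀ i j, Z i j ∈ EvenForm.positiveIdeal V)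
    (hZ' : ∀ i j, Z i j ∈ EvenForm.homogeneous V 1) {y c : EvenForm V}
    (hy : y ∈ EvenForm.positiveIdeal V) (hy' : y ∈ EvenForm.homogeneous V 1)
    (hc : c = (2 : ℂ) • y) :
    formComponent 12 (sqrtDet ((2 : ℂ) • evalSeries divTanhSeries Z) * evalSeries tanhSeries y ^ 2) =
      formComponent 12
        ((-4 * (sqrtDet (evalSeries divSinhSeries Z) *
            (evalSeries expSeries ((2 : ℂ) • Z)).trace) +
          112 * sqrtDet (evalSeries divSinhSeries Z) +
          8 * (sqrtDet (evalSeries divSinhSeries Z) *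
            (evalSeries expSeries c + evalSeries expSeries (-c) - 2))) *
          evalSeries sinhSeries y ^ 2) := by
  have hJ := EvenForm.positiveIdeal_le_nilradical (V := V)
  have hT : ∀ k, (Z ^ k).trace ∈ EvenForm.positiveIdeal V ^ k := fun k =>
    sum_mem fun i _ => Matrix.pow_apply_mem_pow hZ k i i
  have hT' : ∀ k, (Z ^ k).trace ∈ EvenForm.homogeneous V k := fun k =>
    sum_mem fun i _ => EvenForm.matrix_pow_mem_homogeneous hZ' k i i
  have hA := sqrtDet_smul_evalSeries_sub_mem one_ne_zero coeff_divSinhSeries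
    (p := -1 / 12) (q := 1 / 360) (r := 1 / 288) (by norm_num) (by norm_num) (by norm_num) hZ
  rw [one_smul, one_pow, Complex.one_cpow, one_smul] at hA
  have hL := sqrtDet_smul_evalSeries_sub_mem two_ne_zero coeff_divTanhSeries
    (p := 1 / 6) (q := -7 / 180) (r := 1 / 72) (by norm_num) (by norm_num) (by norm_num) hZ
  have h64 : ((2 : ℂ) ^ Fintype.card n) ^ (1 / 2 : ℂ) = 64 := by
    rw [hn, show (2 : ℂ) ^ 12 = 64 ^ 2 by norm_num, one_div]
    exact Complex.sq_cpow_two_inv (by norm_num)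
  rw [h64] at hL
  have hch := trace_expSeries_sub_mem hJ hZ
  rw [hn, Nat.cast_ofNat] at hch
  have hE := expSeries_add_expSeries_neg_sub_mem hJ hy hc
  have ht := tanhSeries_sq_sub_mem hJ hy
  have hs := sinhSeries_sq_sub_mem hJ hy
  have hT1 := hT 1
  have hT1' := hT' 1
  rw [pow_one, pow_one] at hT1
  rw [pow_one] at hT1'
  have hmem := signature_sub_dirac_mem hA hL hch hE ht hs hy hT1 (hT 2) (hT 3) (hT 4)
  refine formComponent_eq_of_sub_sub_mem (by norm_num) hmem ?_
  have hmul : ∀ {i j : ℕ} {a b : EvenForm V}, a ∈ EvenForm.homogeneous V i →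
      b ∈ EvenForm.homogeneous V j → a * b ∈ EvenForm.homogeneous V (i + j) :=
    fun ha hb => EvenForm.mul_mem_homogeneous ha hb
  have hyk := EvenForm.pow_mem_homogeneous hy'
  have hz : ∀ {j : ℕ} (r : ℂ) {a : EvenForm V}, a ∈ EvenForm.homogeneous V j → 2 * j ≠ 12 →
      formComponent 12 (r • a) = 0 := fun r a ha hj => by
    rw [formComponent_smul, formComponent_eq_zero_of_mem_homogeneous hj ha, smul_zero]
  simp only [formComponent_add]
  rw [hz _ (hmul (hT' 2) (hyk 2)) (by norm_num), hz _ (hyk 4) (by norm_num),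
    hz _ (hmul hT1' (hyk 2)) (by norm_num), hz _ (hmul (hT' 3) (hyk 2)) (by norm_num),
    hz _ (hmul (hmul hT1' (hT' 2)) (hyk 2)) (by norm_num), hz _ (hmul hT1' (hyk 4)) (by norm_num)]
  simp only [add_zero]

end CharacteristicForms

/-! ### Curvature and Euler forms -/

section Connections

variable {E : Type*} [NormedAddCommGroup E] [NormedSpace ℝ E] [FiniteDimensional ℝ E]
  {H : Type*} [TopologicalSpace H] {I : ModelWithCorners ℝ E H}
  {M : Type*} [TopologicalSpace M] [ChartedSpace H M] [IsManifold I ∞ M]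

theorem tangentCurvature_mem_positiveIdeal
    (cov : CovariantDerivative I E (TangentSpace I : M → Type _)) (x : M) (i j) :
    tangentCurvature cov x i j ∈ EvenForm.positiveIdeal (TangentSpace I x) := by
  rw [tangentCurvature, CovariantDerivative.curvatureMatrix, Matrix.of_apply]
  exact twoForm_mem_positiveIdeal _

theorem tangentCurvature_mem_homogeneous
    (cov : CovariantDerivative I E (TangentSpace I : M → Type _)) (x : M) (i j) :
    tangentCurvature cov x i j ∈ EvenForm.homogeneous (TangentSpace I x) 1 := by
  rw [tangentCurvature, CovariantDerivative.curvatureMatrix, Matrix.of_apply]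
  exact twoForm_mem_homogeneous _
variable {ξ : M → Type*} [TopologicalSpace (TotalSpace (EuclideanSpace ℝ (Fin 2)) ξ)]
  [∀ x, NormedAddCommGroup (ξ x)] [∀ x, InnerProductSpace ℝ (ξ x)]
  [FiberBundle (EuclideanSpace ℝ (Fin 2)) ξ] [VectorBundle ℝ (EuclideanSpace ℝ (Fin 2)) ξ]

theorem eulerForm_mem_positiveIdeal (cov : CovariantDerivative I (EuclideanSpace ℝ (Fin 2)) ξ)
    (o : PlaneBundleOrientation ξ) (x : M) :
    eulerForm cov o x ∈ EvenForm.positiveIdeal (TangentSpace I x) := by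
  rw [eulerForm]
  exact twoForm_mem_positiveIdeal _

theorem eulerForm_mem_homogeneous (cov : CovariantDerivative I (EuclideanSpace ℝ (Fin 2)) ξ)
    (o : PlaneBundleOrientation ξ) (x : M) :
    eulerForm cov o x ∈ EvenForm.homogeneous (TangentSpace I x) 1 := by
  rw [eulerForm]
  exact twoForm_mem_homogeneous _

end Connections

theorem corollary3p2
    {M : Type*} [TopologicalSpace M] [T2Space M]
    [ChartedSpace (EuclideanSpace ℝ (Fin 12)) M] [IsManifold (𝓡 12) ∞ M]
    (g : ContMDiffRiemannianMetric (𝓡 12) ∞ (EuclideanSpace ℝ (Fin 12))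
      (fun x : M => TangentSpace (𝓡 12) x))
    (nablaTM : CovariantDerivative (𝓡 12) (EuclideanSpace ℝ (Fin 12))
      (fun x : M => TangentSpace (𝓡 12) x))
    (hLC : IsLeviCivita g nablaTM)
    {ξ : M → Type*} [TopologicalSpace (TotalSpace (EuclideanSpace ℝ (Fin 2)) ξ)]
    [∀ x, NormedAddCommGroup (ξ x)] [∀ x, InnerProductSpace ℝ (ξ x)]
    [FiberBundle (EuclideanSpace ℝ (Fin 2)) ξ] [VectorBundle ℝ (EuclideanSpace ℝ (Fin 2)) ξ]
    [ContMDiffVectorBundle ∞ (EuclideanSpace ℝ (Fin 2)) ξ (𝓡 12)]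
    [IsContMDiffRiemannianBundle (𝓡 12) ∞ (EuclideanSpace ℝ (Fin 2)) ξ]
    (o : PlaneBundleOrientation ξ)
    (nablaξ : CovariantDerivative (𝓡 12) (EuclideanSpace ℝ (Fin 2)) ξ)
    (hsmooth : nablaξ.ContMDiffCovariantDerivative ∞)
    (hmetric : nablaξ.IsMetricCompatible) (x : M) :
    let c := eulerForm nablaξ o x
    let half : EvenForm (TangentSpace (𝓡 12) x) := (1 / 2 : ℂ) • c
    formComponent 12 (lHatForm nablaTM x * evalSeries tanhSeries half ^ 2) =
      formComponent 12
        ((-4 * (aHatForm nablaTM x * chernCharacterForm nablaTM x) + 112 * aHatForm nablaTM x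
          + 8 * (aHatForm nablaTM x *
              (evalSeries expSeries c + evalSeries expSeries (-c) - 2)))
          * evalSeries sinhSeries half ^ 2) := by
  intro c half
  have hcard : Fintype.card (Fin (finrank ℝ (TangentSpace (𝓡 12) x))) = 12 := by
    rw [Fintype.card_fin]
    exact finrank_euclideanSpace_fin
  have hhalf : c = (2 : ℂ) • half := by
    simp only [half, smul_smul]
    norm_num
  have hch : (Complex.I / (2 * Real.pi)) • tangentCurvature nablaTM x =
      (2 : ℂ) • ((Complex.I / (4 * Real.pi)) • tangentCurvature nablaTM x) := by
    rw [smul_smul]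
    congr 1
    ring
  have key := formComponent_signature_eq_dirac hcard
    (Z := (Complex.I / (4 * Real.pi)) • tangentCurvature nablaTM x)
    (fun i j => by
      rw [Matrix.smul_apply]
      exact Submodule.smul_of_tower_mem _ _ (tangentCurvature_mem_positiveIdeal nablaTM x i j))
    (fun i j => by
      rw [Matrix.smul_apply]
      exact Submodule.smul_mem _ _ (tangentCurvature_mem_homogeneous nablaTM x i j))
    (y := half) (c := c)
    (Submodule.smul_of_tower_mem _ _ (eulerForm_mem_positiveIdeal nablaξ o x))
    (Submodule.smul_mem _ _ (eulerForm_mem_homogeneous nablaξ o x)) hhalf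
  rw [lHatForm, aHatForm, chernCharacterForm, hch]
  exact key
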